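/- Let $\mathbb{C}(q,t)$ be the field of rational functions in two commuting variables $q,t$. A composition is a finite (possibly empty) tuple $\alpha=(\alpha_1,\dots,\alpha_l)$ of positive integers; write $\ell(\alpha)=l$, $|\alpha|=\alpha_1+\cdots+\alpha_l$, and $\alpha\cdot\beta$ for the concatenation of $\alpha$ and $\beta$. Write $\beta\succeq\alpha$ if $\beta$ is obtained from $\alpha$ by adding up blocks of adjacent parts. Let $\mathsf{QSym}$ be the algebra of quasisymmetric functions over $\mathbb{C}(q,t)$, that is, the span of the monomial quasisymmetric functions $M_\alpha=\sum_{i_1<\cdots<i_l}x_{i_1}^{\alpha_1}\cdots x_{i_l}^{\alpha_l}$ inside the formal power series in $x_1,x_2,\dots$, with the coproduct $\triangle M_\gamma=\sum_{\alpha\cdot\beta=\gamma}M_\alpha\otimes M_\beta$. For a composition $\alpha$ put $$\mathcal{D}_\alpha(q,t)=\sum_{\beta\succeq\alpha}q^{\ell(\beta)-|\alpha|}(-t)^{\ell(\alpha)-\ell(\beta)}M_\beta .$$ Let $\alpha,\beta$ be compositions. A two-way overlapping shuffle of $\alpha$ and $\beta$ is an expression obtained from a shuffle of the sequences $(\alpha_1,\dots,\alpha_l)$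 and $(\beta_1,\dots,\beta_k)$ by replacing the commas in any (possibly empty) selection of consecutive pairs of the form $(\alpha_i,\beta_j)$ with $+_1$, and in any selection of consecutive pairs of the form $(\beta_j,\alpha_i)$ with $+_2$. Every part remembers whether it comes from $\alpha$ or from $\beta$, so shuffles that only agree numerically count as different. For such an expression $\gamma$, let $c_1(\gamma)$ and $c_2(\gamma)$ be the numbers of occurrences of $+_1$ and $+_2$ in $\gamma$, and let $\gamma^+$ be the composition obtained from $\gamma$ by reading $+_1$ and $+_2$ as ordinary addition. Theorem. (a) For all compositions $\alpha,\beta$, $$\mathcal{D}_\alpha(q,t)\,\mathcal{D}_\beta(q,t)=\sum_{\gamma}(q+t)^{c_1(\gamma)}\,t^{c_2(\gamma)}\,\mathcal{D}_{\gamma^+}(q,t),$$ where $\gamma$ runs over the two-way overlapping shuffles of $\alpha$ and $\beta$. (b) For every composition $\gamma$, $$\triangle\mathcal{D}_\gamma(q,t)=\sum_{\alpha\cdot\beta=\gamma}\mathcal{D}_\alpha(q,t)\otimes\mathcal{D}_\beta(q,t).$$ Moreover, the functions $\mathcal{D}_\alpha(q,t)$, for $\alpha$ a composition, form a basis of $\mathsf{QSym}$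 over $\mathbb{C}(q,t)$, and all structure constants of the product and of the coproduct with respect to this basis lie in $\mathbb{N}[q,t]$. -/

import Mathlib

open scoped TensorProduct

namespace QS

/-- Compositions: finite tuples of positive integers (the empty one included). The length is
`List.length`, concatenation is `++`. -/
abbrev Comp := List ℕ+

/-- The size of a composition, the sum of its parts. -/
def size (α : Comp) : ℕ := (α.map (fun a : ℕ+ => (a : ℕ))).sum

/-! ### Monomial quasisymmetric functions -/

/-- The sequence of the nonzero exponents of the monomial `x ^ m`, read in increasing order of the
variables. -/
def expWord (m : ℕ →₀ ℕ) : List ℕ := (m.support.sort (· ≤ ·)).map m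

/-- The monomial quasisymmetric function `M_α`, the formal sum of all monomials
`x_{i₁}^{α₁} ⋯ x_{i_l}^{α_l}` with `i₁ < ⋯ < i_l`, i.e. of all monomials whose nonzero exponents,
read in order, are `α₁, …, α_l`. -/
noncomputable def monomialSeries (R : Type*) [CommRing R] (α : Comp) : MvPowerSeries ℕ R :=
  fun m => if expWord m = α.map (fun a : ℕ+ => (a : ℕ)) then 1 else 0

theorem coeff_monomialSeries {R : Type*} [CommRing R] (α : Comp) (m : ℕ →₀ ℕ) :
    MvPowerSeries.coeff m (monomialSeries R α) =
      if expWord m = α.map (fun a : ℕ+ => (a : ℕ)) then 1 else 0 := rfl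

theorem map_coe_injective :
    Function.Injective (fun α : Comp => α.map (fun a : ℕ+ => (a : ℕ))) :=
  List.map_injective_iff.2 PNat.coe_injective

theorem expWord_pos {m : ℕ →₀ ℕ} {a : ℕ} (h : a ∈ expWord m) : 0 < a := by
  simp only [expWord, List.mem_map, Finset.mem_sort, Finsupp.mem_support_iff] at h
  obtain ⟨i, hi, rfl⟩ := h
  omega

theorem expWord_eq_comp (m : ℕ →₀ ℕ) :
    ∃ α : Comp, expWord m = α.map (fun a : ℕ+ => (a : ℕ)) := by
  have h : ∀ l : List ℕ, (∀ a ∈ l, 0 < a) → ∃ α : Comp, l = α.map (fun a : ℕ+ => (a : ℕ)) := by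
    intro l
    induction l with
    | nil => exact fun _ => ⟨[], rfl⟩
    | cons a l ih =>
      intro h
      obtain ⟨α, rfl⟩ := ih fun b hb => h b (by simp [hb])
      exact ⟨Nat.toPNat a (h a (by simp)) :: α, rfl⟩
  exact h _ fun a ha => expWord_pos ha

theorem expWord_sum (m : ℕ →₀ ℕ) : (expWord m).sum = m.sum fun _ a => a := by
  rw [expWord, ← Multiset.sum_coe, ← Multiset.map_coe, Finset.sort_eq]
  rfl

/-- The monomial with exponents `α₁, α₂, …` on the first variables. -/
noncomputable def leadingExp (α : Comp) : ℕ →₀ ℕ :=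
  (α.map (fun a : ℕ+ => (a : ℕ))).toFinsupp

theorem leadingExp_apply (α : Comp) (i : ℕ) :
    leadingExp α i = (α.map (fun a : ℕ+ => (a : ℕ))).getD i 0 := rfl

theorem leadingExp_support (α : Comp) : (leadingExp α).support = Finset.range α.length := by
  ext i
  rw [Finsupp.mem_support_iff, leadingExp_apply, Finset.mem_range]
  by_cases h : i < α.length
  · simp [h, List.getD]
  · simp [h, List.getD]

theorem expWord_leadingExp (α : Comp) :
    expWord (leadingExp α) = α.map (fun a : ℕ+ => (a : ℕ)) := by
  rw [expWord, leadingExp_support, Finset.sort_range]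
  apply List.ext_getElem
  · simp
  · intro i h1 h2
    simp at h1
    simp [leadingExp_apply, List.getD, h1]

theorem expWord_mapDomain (φ : ℕ → ℕ) (m : ℕ →₀ ℕ) (h : StrictMonoOn φ (m.support : Set ℕ)) :
    expWord (m.mapDomain φ) = expWord m := by
  classical
  have hs : (m.mapDomain φ).support = m.support.image φ :=
    Finsupp.mapDomain_support_of_injOn _ h.injOn
  have hsort : (m.support.image φ).sort (· ≤ ·) = (m.support.sort (· ≤ ·)).map φ := by
    apply List.Perm.eq_of_pairwise (le := (· ≤ ·))
    · intro a b _ _ h1 h2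
      exact le_antisymm h1 h2
    · exact Finset.pairwise_sort _ _
    · rw [List.pairwise_map]
      refine (Finset.pairwise_sort m.support (· ≤ ·)).imp_of_mem ?_
      intro a b ha hb hab
      exact h.monotoneOn (by simpa using ha) (by simpa using hb) hab
    · rw [← Multiset.coe_eq_coe, ← Multiset.map_coe, Finset.sort_eq, Finset.sort_eq]
      exact Finset.image_val_of_injOn h.injOn
  rw [expWord, hs, hsort, List.map_map, expWord]
  apply List.map_congr_left
  intro a ha
  exact Finsupp.mapDomain_apply' (S := (m.support : Set ℕ)) m subset_rfl h.injOn
    (by simpa using ha)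

theorem exists_relabel {m : ℕ →₀ ℕ} {α : Comp}
    (h : expWord m = α.map (fun a : ℕ+ => (a : ℕ))) :
    ∃ φ ψ : ℕ → ℕ, StrictMonoOn φ ((leadingExp α).support : Set ℕ) ∧
      StrictMonoOn ψ (m.support : Set ℕ) ∧ (∀ i ∈ (leadingExp α).support, ψ (φ i) = i) ∧
      (∀ i ∈ m.support, φ (ψ i) = i) ∧ (leadingExp α).mapDomain φ = m ∧
      m.mapDomain ψ = leadingExp α := by
  classical
  set s := m.support.sort (· ≤ ·) with hs
  have hlen : s.length = α.length := by
    have := congrArg List.length h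
    simpa only [expWord, List.length_map] using this
  have hmono : StrictMonoOn (fun i => s.getD i 0) ((leadingExp α).support : Set ℕ) := by
    intro i hi j hj hij
    simp only [leadingExp_support, Finset.coe_range, Set.mem_Iio] at hi hj
    have hi' : i < s.length := by omega
    have hj' : j < s.length := by omega
    simp only [List.getD_eq_getElem _ _ hi', List.getD_eq_getElem _ _ hj']
    exact (Finset.sortedLT_sort m.support).strictMono_get (show (⟨i, hi'⟩ : Fin _) < ⟨j, hj'⟩ from hij)
  have hψφ : ∀ i ∈ (leadingExp α).support, s.idxOf (s.getD i 0) = i := by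
    intro i hi
    simp only [leadingExp_support, Finset.mem_range] at hi
    have hi' : i < s.length := by omega
    rw [List.getD_eq_getElem _ _ hi']
    exact (Finset.sort_nodup _ _).idxOf_getElem i hi'
  have hφψ : ∀ i ∈ m.support, s.getD (s.idxOf i) 0 = i := by
    intro i hi
    have hi' : i ∈ s := by simpa [hs] using hi
    rw [List.getD_eq_getElem _ _ (List.idxOf_lt_length_of_mem hi')]
    simp
  have hψmem : ∀ i ∈ m.support, s.idxOf i ∈ (leadingExp α).support := by
    intro i hi
    have hi' : i ∈ s := by simpa [hs] using hi
    rw [leadingExp_support, Finset.mem_range, ← hlen]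
    exact List.idxOf_lt_length_of_mem hi'
  have hψmono : StrictMonoOn (fun i => s.idxOf i) (m.support : Set ℕ) := by
    intro i hi j hj hij
    have h1 := hψmem i hi
    have h2 := hψmem j hj
    by_contra hcon
    have := hmono.monotoneOn h2 h1 (not_lt.1 hcon)
    simp only [hφψ i hi, hφψ j hj] at this
    omega
  have hmap : m.mapDomain (fun i => s.idxOf i) = leadingExp α := by
    ext i
    by_cases hi : i < α.length
    · have hi' : i < s.length := by omega
      have hmem : s[i] ∈ m.support := by
        have : s[i] ∈ s := List.getElem_mem _
        exact (Finset.mem_sort (· ≤ ·)).1 this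
      have e : i = s.idxOf s[i] := ((Finset.sort_nodup _ _).idxOf_getElem i hi').symm
      have h1 : m.mapDomain (fun i => s.idxOf i) (s.idxOf s[i]) = m s[i] :=
        Finsupp.mapDomain_apply' (S := (m.support : Set ℕ)) m subset_rfl hψmono.injOn hmem
      rw [← e] at h1
      rw [h1, leadingExp_apply, ← h, expWord, ← hs, List.getD_eq_getElem _ _ (by simpa using hi')]
      simp
    · have h1 : i ∉ (leadingExp α).support := by simpa [leadingExp_support] using hi
      rw [Finsupp.notMem_support_iff.1 h1, ← Finsupp.notMem_support_iff]
      intro hcon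
      have := Finsupp.mapDomain_support hcon
      rw [Finset.mem_image] at this
      obtain ⟨j, hj, rfl⟩ := this
      exact h1 (hψmem j hj)
  refine ⟨fun i => s.getD i 0, fun i => s.idxOf i, hmono, hψmono, hψφ, hφψ, ?_, hmap⟩
  rw [← hmap, ← Finsupp.mapDomain_comp]
  conv_rhs => rw [← Finsupp.mapDomain_id (v := m)]
  exact Finsupp.mapDomain_congr fun i hi => hφψ i hi

theorem support_subset_of_add {p q m : ℕ →₀ ℕ} (h : p + q = m) :
    p.support ⊆ m.support ∧ q.support ⊆ m.support := by
  subst h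
  constructor
  · intro i hi
    simp only [Finsupp.mem_support_iff, Finsupp.add_apply] at hi ⊢
    omega
  · intro i hi
    simp only [Finsupp.mem_support_iff, Finsupp.add_apply] at hi ⊢
    omega

theorem coeff_mul_eq_leadingExp {R : Type*} [CommRing R] (α β : Comp) {m : ℕ →₀ ℕ} {γ : Comp}
    (h : expWord m = γ.map (fun a : ℕ+ => (a : ℕ))) :
    MvPowerSeries.coeff m (monomialSeries R α * monomialSeries R β) =
      MvPowerSeries.coeff (leadingExp γ) (monomialSeries R α * monomialSeries R β) := by
  classical
  obtain ⟨φ, ψ, hφ, hψ, hψφ, hφψ, hm, hm'⟩ := exists_relabel h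
  rw [MvPowerSeries.coeff_mul, MvPowerSeries.coeff_mul]
  refine Finset.sum_nbij' (fun p => (p.1.mapDomain ψ, p.2.mapDomain ψ))
    (fun p => (p.1.mapDomain φ, p.2.mapDomain φ)) ?_ ?_ ?_ ?_ ?_
  · intro p hp
    rw [Finset.HasAntidiagonal.mem_antidiagonal] at hp ⊢
    rw [← Finsupp.mapDomain_add, hp, hm']
  · intro p hp
    rw [Finset.HasAntidiagonal.mem_antidiagonal] at hp ⊢
    rw [← Finsupp.mapDomain_add, hp, hm]
  · intro p hp
    rw [Finset.HasAntidiagonal.mem_antidiagonal] at hp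
    obtain ⟨h1, h2⟩ := support_subset_of_add hp
    have key : ∀ r : ℕ →₀ ℕ, r.support ⊆ m.support → (r.mapDomain ψ).mapDomain φ = r := by
      intro r hr
      rw [← Finsupp.mapDomain_comp]
      conv_rhs => rw [← Finsupp.mapDomain_id (v := r)]
      exact Finsupp.mapDomain_congr fun i hi => hφψ i (hr hi)
    simp [key _ h1, key _ h2]
  · intro p hp
    rw [Finset.HasAntidiagonal.mem_antidiagonal] at hp
    obtain ⟨h1, h2⟩ := support_subset_of_add hp
    have key : ∀ r : ℕ →₀ ℕ, r.support ⊆ (leadingExp γ).support →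
        (r.mapDomain φ).mapDomain ψ = r := by
      intro r hr
      rw [← Finsupp.mapDomain_comp]
      conv_rhs => rw [← Finsupp.mapDomain_id (v := r)]
      exact Finsupp.mapDomain_congr fun i hi => hψφ i (hr hi)
    simp [key _ h1, key _ h2]
  · intro p hp
    rw [Finset.HasAntidiagonal.mem_antidiagonal] at hp
    obtain ⟨h1, h2⟩ := support_subset_of_add hp
    simp only [coeff_monomialSeries]
    rw [expWord_mapDomain ψ p.1 (hψ.mono (by exact_mod_cast h1)),
      expWord_mapDomain ψ p.2 (hψ.mono (by exact_mod_cast h2))]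

theorem size_eq_of_coeff_mul_ne_zero {R : Type*} [CommRing R] (α β : Comp) {m : ℕ →₀ ℕ}
    (h : MvPowerSeries.coeff m (monomialSeries R α * monomialSeries R β) ≠ 0) :
    (expWord m).sum = size α + size β := by
  classical
  rw [MvPowerSeries.coeff_mul] at h
  obtain ⟨p, hp, hne⟩ := Finset.exists_ne_zero_of_sum_ne_zero h
  rw [Finset.HasAntidiagonal.mem_antidiagonal] at hp
  simp only [coeff_monomialSeries] at hne
  have h1 : expWord p.1 = α.map (fun a : ℕ+ => (a : ℕ)) := by
    by_contra hc
    simp [hc] at hne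
  have h2 : expWord p.2 = β.map (fun a : ℕ+ => (a : ℕ)) := by
    by_contra hc
    simp [hc] at hne
  rw [← hp, expWord_sum, Finsupp.sum_add_index' (by simp) (by simp), ← expWord_sum, ← expWord_sum,
    h1, h2]
  rfl

theorem finite_size_eq (n : ℕ) : {γ : Comp | size γ = n}.Finite := by
  have : Finite {γ : Comp // size γ = n} := by
    refine Finite.of_injective (β := Composition n)
      (fun γ => ⟨γ.1.map (fun a : ℕ+ => (a : ℕ)), ?_, γ.2⟩) ?_
    · intro i hi
      rw [List.mem_map] at hi
      obtain ⟨a, _, rfl⟩ := hi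
      exact a.pos
    · intro γ δ h
      exact Subtype.ext (map_coe_injective (congrArg Composition.blocks h))
  exact this

theorem monomialSeries_mul_mem (R : Type*) [CommRing R] (α β : Comp) :
    monomialSeries R α * monomialSeries R β ∈
      Submodule.span R (Set.range (monomialSeries R)) := by
  classical
  have key : monomialSeries R α * monomialSeries R β =
      ∑ γ ∈ (finite_size_eq (size α + size β)).toFinset,
        MvPowerSeries.coeff (leadingExp γ) (monomialSeries R α * monomialSeries R β) •
          monomialSeries R γ := by
    ext m
    obtain ⟨δ, hδ⟩ := expWord_eq_comp m
    rw [map_sum]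
    simp only [MvPowerSeries.coeff_smul, coeff_monomialSeries]
    by_cases hmem : size δ = size α + size β
    · rw [Finset.sum_eq_single_of_mem δ (by simpa using hmem), hδ, if_pos rfl, mul_one]
      · exact coeff_mul_eq_leadingExp α β hδ
      · intro γ _ hγ
        rw [if_neg, mul_zero]
        intro hc
        exact hγ (map_coe_injective (hc.symm.trans hδ))
    · rw [Finset.sum_eq_zero]
      · by_contra hne
        have := size_eq_of_coeff_mul_ne_zero α β hne
        rw [hδ] at this
        exact hmem this
      · intro γ hγ
        rw [if_neg, mul_zero]
        intro hc
        have : γ = δ := map_coe_injective (hc.symm.trans hδ)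
        subst this
        exact hmem (by simpa using hγ)
  rw [key]
  exact Submodule.sum_mem _ fun γ _ =>
    Submodule.smul_mem _ _ (Submodule.subset_span ⟨γ, rfl⟩)

theorem monomialSeries_nil (R : Type*) [CommRing R] : monomialSeries R [] = 1 := by
  classical
  ext m
  rw [coeff_monomialSeries, MvPowerSeries.coeff_one]
  congr 1
  rw [List.map_nil, expWord, List.map_eq_nil_iff, ← List.length_eq_zero_iff, Finset.length_sort,
    Finset.card_eq_zero, Finsupp.support_eq_empty]

/-- The algebra of quasisymmetric functions over `R`: the span of the monomial quasisymmetric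
functions inside the algebra of formal power series in `x₁, x₂, …`. -/
noncomputable def QSym (R : Type*) [CommRing R] : Subalgebra R (MvPowerSeries ℕ R) :=
  (Submodule.span R (Set.range (monomialSeries R))).toSubalgebra
    (monomialSeries_nil R ▸ Submodule.subset_span ⟨[], rfl⟩)
    (by
      intro f g hf hg
      have h := Submodule.mul_mem_mul hf hg
      rw [Submodule.span_mul_span] at h
      refine Submodule.span_le.2 ?_ h
      rintro _ ⟨_, ⟨α, rfl⟩, _, ⟨β, rfl⟩, rfl⟩
      exact monomialSeries_mul_mem R α β)

/-- The monomial quasisymmetric function `M_α` as an element of `QSym`. -/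
noncomputable def M (R : Type*) [CommRing R] (α : Comp) : QSym R :=
  ⟨monomialSeries R α, Submodule.subset_span ⟨α, rfl⟩⟩

theorem linearIndependent_M (R : Type*) [CommRing R] : LinearIndependent R (M R) := by
  classical
  rw [linearIndependent_iff']
  intro s c h γ hγ
  have h1 : ∑ α ∈ s, c α • monomialSeries R α = 0 := by
    have := congrArg (QSym R).val h
    simpa [M] using this
  have h2 := congrArg (MvPowerSeries.coeff (leadingExp γ)) h1
  rw [map_sum, map_zero] at h2
  simp only [MvPowerSeries.coeff_smul, coeff_monomialSeries, expWord_leadingExp] at h2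
  rw [Finset.sum_eq_single_of_mem γ hγ, if_pos rfl, mul_one] at h2
  · exact h2
  · intro δ _ hδ
    rw [if_neg, mul_zero]
    intro hc
    exact hδ (map_coe_injective hc).symm

theorem span_M (R : Type*) [CommRing R] : ⊤ ≤ Submodule.span R (Set.range (M R)) := by
  rintro ⟨f, hf⟩ -
  have hf' : f ∈ Submodule.span R (Set.range (monomialSeries R)) := hf
  have hr : Set.range (monomialSeries R) = (QSym R).val.toLinearMap '' Set.range (M R) := by
    rw [← Set.range_comp]
    rfl
  rw [hr, Submodule.span_image, Submodule.mem_map] at hf'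
  obtain ⟨g, hg, hgf⟩ := hf'
  have : g = ⟨f, hf⟩ := Subtype.ext hgf
  exact this ▸ hg

/-- The monomial quasisymmetric functions form a basis of `QSym`. -/
noncomputable def basisM (R : Type*) [CommRing R] : Module.Basis Comp R (QSym R) :=
  Module.Basis.mk (linearIndependent_M R) (span_M R)

theorem basisM_apply (R : Type*) [CommRing R] (α : Comp) : basisM R α = M R α :=
  Module.Basis.mk_apply _ _ α

/-- The pairs of compositions `(α, β)` with concatenation `α ⬝ β = γ`. -/
def deconcatenations (γ : Comp) : Finset (Comp × Comp) :=
  (Finset.range (γ.length + 1)).image fun i => (γ.take i, γ.drop i)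

theorem mem_deconcatenations {γ : Comp} {p : Comp × Comp} :
    p ∈ deconcatenations γ ↔ p.1 ++ p.2 = γ := by
  simp only [deconcatenations, Finset.mem_image, Finset.mem_range]
  constructor
  · rintro ⟨i, _, rfl⟩
    simp
  · rintro rfl
    exact ⟨p.1.length, by simp, by simp⟩

/-- The coproduct of `QSym`: the linear map with `Δ M_γ = ∑_{α ⬝ β = γ} M_α ⊗ M_β`. -/
noncomputable def coproduct (R : Type*) [CommRing R] : QSym R →ₗ[R] QSym R ⊗[R] QSym R :=
  (basisM R).constr R fun γ => ∑ p ∈ deconcatenations γ, M R p.1 ⊗ₜ[R] M R p.2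

theorem coproduct_M (R : Type*) [CommRing R] (γ : Comp) :
    coproduct R (M R γ) = ∑ p ∈ deconcatenations γ, M R p.1 ⊗ₜ[R] M R p.2 := by
  rw [coproduct, ← basisM_apply, Module.Basis.constr_basis]

/-! ### Refinement and the functions `D_α(q,t)` -/

/-- `α` refines `β`: cutting `α` into consecutive (automatically nonempty) blocks and adding up each
block gives `β`. -/
def Refines (α β : Comp) : Prop :=
  ∃ L : List Comp, L.flatten = α ∧ List.Forall₂ (fun (B : Comp) (b : ℕ+) => size B = (b : ℕ)) L β

/-- The list of the compositions obtained by combining adjacent parts. -/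
def coarseningList : Comp → List Comp
  | [] => [[]]
  | a :: α => (coarseningList α).flatMap fun β =>
      match β with
      | [] => [[a]]
      | b :: β' => [a :: b :: β', (a + b) :: β']

/-- The finite set of all `β` such that `α` refines `β`. -/
def coarsenings (α : Comp) : Finset Comp := (coarseningList α).toFinset

theorem mem_coarseningList_cons {a : ℕ+} {α γ : Comp} :
    γ ∈ coarseningList (a :: α) ↔
      ∃ β ∈ coarseningList α, γ = a :: β ∨ ∃ b β', β = b :: β' ∧ γ = (a + b) :: β' := by
  simp only [coarseningList, List.mem_flatMap]
  refine exists_congr fun β => and_congr_right fun _ => ?_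
  cases β <;> simp

theorem refines_cons {a : ℕ+} {α γ : Comp} :
    Refines (a :: α) γ ↔
      ∃ β, Refines α β ∧ (γ = a :: β ∨ ∃ b β', β = b :: β' ∧ γ = (a + b) :: β') := by
  constructor
  · rintro ⟨L, hL, hF⟩
    cases hF with
    | nil => simp at hL
    | @cons B c L' γ' hc hF' =>
      cases B with
      | nil =>
        have := c.pos
        simp only [size, List.map_nil, List.sum_nil] at hc
        omega
      | cons a' B =>
        simp only [List.flatten_cons, List.cons_append, List.cons.injEq] at hL
        obtain ⟨rfl, rfl⟩ := hL
        simp only [size, List.map_cons, List.sum_cons] at hc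
        cases B with
        | nil =>
          refine ⟨γ', ⟨L', by simp, hF'⟩, Or.inl ?_⟩
          congr 1
          apply PNat.coe_injective
          simpa using hc.symm
        | cons b B =>
          have hpos : 0 < size (b :: B) := by
            simp only [size, List.map_cons, List.sum_cons]
            have := b.pos
            omega
          refine ⟨Nat.toPNat _ hpos :: γ', ⟨(b :: B) :: L', rfl, List.Forall₂.cons rfl hF'⟩,
            Or.inr ⟨_, _, rfl, ?_⟩⟩
          congr 1
          apply PNat.coe_injective
          rw [PNat.add_coe]
          exact hc.symm
  · rintro ⟨β, ⟨L, rfl, hF⟩, rfl | ⟨b, β', rfl, rfl⟩⟩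
    · exact ⟨[a] :: L, rfl, List.Forall₂.cons (by simp [size]) hF⟩
    · cases hF with
      | @cons B _ L' _ hb hF' =>
        refine ⟨(a :: B) :: L', rfl, List.Forall₂.cons ?_ hF'⟩
        rw [PNat.add_coe, ← hb]
        simp [size]

theorem mem_coarsenings {α β : Comp} : β ∈ coarsenings α ↔ Refines α β := by
  rw [coarsenings, List.mem_toFinset]
  induction α generalizing β with
  | nil =>
    simp only [coarseningList, List.mem_singleton]
    constructor
    · rintro rfl
      exact ⟨[], rfl, List.Forall₂.nil⟩
    · rintro ⟨L, hL, hF⟩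
      cases hF with
      | nil => rfl
      | @cons B c L' γ' hc hF' =>
        simp only [List.flatten_cons, List.append_eq_nil_iff] at hL
        have := c.pos
        rw [hL.1] at hc
        simp only [size, List.map_nil, List.sum_nil] at hc
        omega
  | cons a α ih =>
    rw [mem_coarseningList_cons, refines_cons]
    exact exists_congr fun γ => and_congr_left fun _ => ih

/-- The field `ℂ(q,t)` of rational functions in two variables. -/
abbrev Cqt : Type := FractionRing (MvPolynomial (Fin 2) ℂ)

/-- The variable `q` of `ℂ(q,t)`. -/
noncomputable def q : Cqt := algebraMap (MvPolynomial (Fin 2) ℂ) Cqt (MvPolynomial.X 0)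

/-- The variable `t` of `ℂ(q,t)`. -/
noncomputable def t : Cqt := algebraMap (MvPolynomial (Fin 2) ℂ) Cqt (MvPolynomial.X 1)

/-- `D_α(q,t) = ∑_{β ⪰ α} q^{ℓ(β) - |α|} (-t)^{ℓ(α) - ℓ(β)} M_β`. -/
noncomputable def D (α : Comp) : QSym Cqt :=
  ∑ β ∈ coarsenings α,
    (q ^ ((β.length : ℤ) - (size α : ℤ)) * (-t) ^ ((α.length : ℤ) - (β.length : ℤ))) • M Cqt β

/-- The rational functions lying in `ℕ[q,t]`. -/
def natPolynomials : Set Cqt :=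
  Set.range (MvPolynomial.aeval ![q, t] : MvPolynomial (Fin 2) ℕ →ₐ[ℕ] Cqt)

/-! ### Two-way overlapping shuffles -/

/-- A part coming from `α` (`Sum.inl`) or from `β` (`Sum.inr`). -/
abbrev Letter := ℕ+ ⊕ ℕ+

/-- The positive integer underlying a letter. -/
def Letter.val : Letter → ℕ+
  | Sum.inl a => a
  | Sum.inr b => b

/-- The symbols that can separate two consecutive parts of an expression: `,`, `+₁` and `+₂`. -/
inductive Sep
  | comma
  | plus1
  | plus2
  deriving DecidableEq

/-- An expression such as `(α₁ +₁ β₁, α₂)`: a word of letters, each of them followed by a separator.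
The separator after the last letter only serves to end the word and is always a comma. -/
abbrev Expression := List (Letter × Sep)

/-- The condition on the separators of an expression: `+₁` only occurs within a consecutive pair
`(α_i, β_j)`, and `+₂` only within a consecutive pair `(β_j, α_i)`. -/
def SepsAllowed : Expression → Prop
  | [] => True
  | [(_, s)] => s = Sep.comma
  | (x, s) :: (y, s') :: r =>
      (s = Sep.plus1 → x.isLeft ∧ y.isRight) ∧ (s = Sep.plus2 → x.isRight ∧ y.isLeft) ∧
        SepsAllowed ((y, s') :: r)

/-- `γ` is a two-way overlapping shuffle of `α` and `β`: its letters shuffle `α` and `β`, i.e. the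
letters from `α` read `α` and the letters from `β` read `β`, and its separators are allowed. As
letters remember where they come from, shuffles of `α` and `β` that only agree as compositions are
different words. -/
def IsTwoWayShuffle (α β : Comp) (γ : Expression) : Prop :=
  γ.filterMap (fun x => x.1.getLeft?) = α ∧ γ.filterMap (fun x => x.1.getRight?) = β ∧
    SepsAllowed γ

/-- The list of all shuffles of `α` and `β`. -/
def shuffleList : Comp → Comp → List (List Letter)
  | [], β => [β.map Sum.inr]
  | a :: α, [] => [(a :: α).map Sum.inl]
  | a :: α, b :: β =>
      (shuffleList α (b :: β)).map (Sum.inl a :: ·) ++ (shuffleList (a :: α) β).map (Sum.inr b :: ·)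

/-- The separators allowed between two consecutive letters. -/
def allowedSeps : Letter → Letter → List Sep
  | Sum.inl _, Sum.inr _ => [Sep.comma, Sep.plus1]
  | Sum.inr _, Sum.inl _ => [Sep.comma, Sep.plus2]
  | _, _ => [Sep.comma]

/-- All ways to put allowed separators between the letters of a word. -/
def separate : List Letter → List Expression
  | [] => [[]]
  | [x] => [[(x, Sep.comma)]]
  | x :: y :: w => (allowedSeps x y).flatMap fun s => (separate (y :: w)).map ((x, s) :: ·)

/-- The finite set of two-way overlapping shuffles of `α` and `β`. -/
def twoWayShuffles (α β : Comp) : Finset Expression :=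
  ((shuffleList α β).flatMap separate).toFinset

theorem mem_shuffleList {α β : Comp} {w : List Letter} :
    w ∈ shuffleList α β ↔
      w.filterMap Sum.getLeft? = α ∧ w.filterMap Sum.getRight? = β := by
  have hR : ∀ l : Comp, (l.map Sum.inr : List Letter).filterMap Sum.getLeft? = [] ∧
      (l.map Sum.inr : List Letter).filterMap Sum.getRight? = l := by
    intro l; induction l <;> simp_all
  have hL : ∀ l : Comp, (l.map Sum.inl : List Letter).filterMap Sum.getRight? = [] ∧
      (l.map Sum.inl : List Letter).filterMap Sum.getLeft? = l := by
    intro l; induction l <;> simp_all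
  have hR' : ∀ w : List Letter, w.filterMap Sum.getLeft? = [] →
      w = (w.filterMap Sum.getRight?).map Sum.inr := by
    intro w
    induction w with
    | nil => simp
    | cons x w ih =>
      cases x with
      | inl a => simp
      | inr a => simpa using ih
  have hL' : ∀ w : List Letter, w.filterMap Sum.getRight? = [] →
      w = (w.filterMap Sum.getLeft?).map Sum.inl := by
    intro w
    induction w with
    | nil => simp
    | cons x w ih =>
      cases x with
      | inl a => simpa using ih
      | inr a => simp
  induction α, β using shuffleList.induct generalizing w with
  | case1 β =>
    rw [shuffleList, List.mem_singleton]
    constructor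
    · rintro rfl
      exact hR β
    · rintro ⟨h1, rfl⟩
      exact hR' w h1
  | case2 a α =>
    rw [shuffleList, List.mem_singleton]
    constructor
    · rintro rfl
      exact (hL (a :: α)).symm
    · rintro ⟨h1, h2⟩
      rw [← h1]
      exact hL' w h2
  | case3 a α b β ih1 ih2 =>
    rw [shuffleList, List.mem_append, List.mem_map, List.mem_map]
    constructor
    · rintro (⟨v, hv, rfl⟩ | ⟨v, hv, rfl⟩)
      · have hv := ih1.1 hv
        exact ⟨by simp [hv.1], hv.2⟩
      · have hv := ih2.1 hv
        exact ⟨hv.1, by simp [hv.2]⟩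
    · rintro ⟨h1, h2⟩
      cases w with
      | nil => simp at h1
      | cons x w =>
        cases x with
        | inl c =>
          simp at h1 h2
          exact Or.inl ⟨w, ih1.2 ⟨h1.2, h2⟩, by rw [h1.1]⟩
        | inr c =>
          simp at h1 h2
          exact Or.inr ⟨w, ih2.2 ⟨h1, h2.2⟩, by rw [h2.1]⟩

theorem mem_separate {w : List Letter} {γ : Expression} :
    γ ∈ separate w ↔ γ.map Prod.fst = w ∧ SepsAllowed γ := by
  induction w using separate.induct generalizing γ with
  | case1 =>
    simp only [separate, List.mem_singleton, List.map_eq_nil_iff]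
    constructor
    · rintro rfl
      exact ⟨rfl, trivial⟩
    · exact And.left
  | case2 x =>
    simp only [separate, List.mem_singleton]
    constructor
    · rintro rfl
      exact ⟨rfl, rfl⟩
    · rintro ⟨h1, h2⟩
      match γ, h1, h2 with
      | [(y, s)], h1, h2 =>
        simp at h1
        simp only [SepsAllowed] at h2
        rw [h1, h2]
  | case3 x y w ih =>
    simp only [separate, List.mem_flatMap, List.mem_map]
    constructor
    · rintro ⟨s, hs, δ, hδ, rfl⟩
      rw [ih] at hδ
      obtain ⟨h1, h2⟩ := hδ
      match δ, h1, h2 with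
      | (y', s') :: r, h1, h2 =>
        simp only [List.map_cons, List.cons.injEq] at h1
        obtain ⟨rfl, rfl⟩ := h1
        refine ⟨rfl, ?_, ?_, h2⟩ <;> rintro rfl <;> cases x <;> cases y' <;>
          simp_all [allowedSeps]
    · rintro ⟨h1, h2⟩
      match γ, h1, h2 with
      | (x', s) :: (y', s') :: r, h1, h2 =>
        simp only [List.map_cons, List.cons.injEq] at h1
        obtain ⟨rfl, rfl, rfl⟩ := h1
        refine ⟨s, ?_, (y', s') :: r, ih.2 ⟨rfl, h2.2.2⟩, rfl⟩
        have ha := h2.1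
        have hb := h2.2.1
        cases s <;> cases x' <;> cases y' <;> simp_all [allowedSeps]

theorem mem_twoWayShuffles {α β : Comp} {γ : Expression} :
    γ ∈ twoWayShuffles α β ↔ IsTwoWayShuffle α β γ := by
  simp only [twoWayShuffles, List.mem_toFinset, List.mem_flatMap, mem_separate, mem_shuffleList,
    IsTwoWayShuffle]
  constructor
  · rintro ⟨w, ⟨h1, h2⟩, rfl, h3⟩
    rw [List.filterMap_map] at h1 h2
    exact ⟨h1, h2, h3⟩
  · rintro ⟨h1, h2, h3⟩
    refine ⟨γ.map Prod.fst, ⟨?_, ?_⟩, rfl, h3⟩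
    · rw [List.filterMap_map]
      exact h1
    · rw [List.filterMap_map]
      exact h2

/-- The number of occurrences of `+₁` in `γ`. -/
def c1 (γ : Expression) : ℕ := γ.countP fun x => x.2 = Sep.plus1

/-- The number of occurrences of `+₂` in `γ`. -/
def c2 (γ : Expression) : ℕ := γ.countP fun x => x.2 = Sep.plus2

/-- The composition `γ⁺` obtained from `γ` by reading `+₁` and `+₂` as the usual addition. -/
def plus : Expression → Comp
  | [] => []
  | (x, Sep.comma) :: r => x.val :: plus r
  | (x, _) :: r =>
      match plus r with
      | [] => [x.val]
      | b :: β => (x.val + b) :: β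

end QS

/-! Everything is reduced to two operators acting on the first part of a quasisymmetric function:
`prepend a` puts a new part `a` in front of every `M_β`, and `absorb a` adds `a` to the first part
and kills constants. With `r = q⁻¹`, the sum over coarsenings satisfies `D_{a⬝α} = q r^a prepend a
D_α - t r^a absorb a D_α`, since the new part either stays separate or is fused with the first
block. This is `attach`; the rescaled `merge r a = r^a absorb a` sends `D_{b⬝β}` to `D_{(a+b)⬝β}`.

Product: the quasi-shuffle recursion `prepend_mul_prepend` splits `f * g` according to the origin of
its first part. Let `rightHalf f g` collect the terms whose first part comes from `g` alone. Then
`attach_mul_sub_rightHalf` and `rightHalf_attach` express the two halves through `attach` plus a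
correction by `merge`, with weight `q + t` acting on the right half and weight `t` acting on the
other half. A two-way overlapping shuffle obeys the same recursion: `+₁` may follow a left letter
only if a right letter comes next, and `+₂` the other way round. So `rightHalf D_α D_β` is the sum
over shuffles that start with a part of `β`, and induction on the shuffle recursion
(`sum_shuffleList`) proves (a).

Coproduct: an operator that changes only the first part acts on the left tensor factor unless that
factor is empty; `coproduct_attach` turns this into the induction for (b).

Basis: solving the definition of `attach` for `prepend` gives an explicit inverse of the map `M_α ↦
D_α`. Positivity of the structure constants can then be read off from (a) and (b). -/

namespace QS

/-! ### Splitting off the first variable of a power series. -/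

section Shift

open Finsupp

/-- The shift `i ↦ i + 1` of the indices of the variables. -/
def succEmb : ℕ ↪ ℕ := ⟨Nat.succ, Nat.succ_injective⟩

theorem exists_eq_single_add_embDomain (m : ℕ →₀ ℕ) :
    ∃ m', m = single 0 (m 0) + embDomain succEmb m' := by
  refine ⟨m.comapDomain succEmb succEmb.injective.injOn, ?_⟩
  ext i
  cases i with
  | zero =>
    rw [Finsupp.add_apply, single_eq_same, embDomain_of_notMem_range _ _ _ (by
      rintro ⟨j, hj⟩; cases hj), add_zero]
  | succ i =>
    have h := embDomain_apply_self succEmb (m.comapDomain succEmb succEmb.injective.injOn) i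
    rw [Finsupp.add_apply, single_eq_of_ne (by omega), zero_add]
    exact h.symm

theorem embDomain_succEmb_zero (m : ℕ →₀ ℕ) : embDomain succEmb m 0 = 0 :=
  embDomain_of_notMem_range _ _ _ (by rintro ⟨j, hj⟩; cases hj)

theorem expWord_embDomain_succEmb (m : ℕ →₀ ℕ) : expWord (embDomain succEmb m) = expWord m := by
  rw [embDomain_eq_mapDomain]
  exact expWord_mapDomain _ _ fun i _ j _ h => Nat.succ_lt_succ h

theorem expWord_single_add (k : ℕ) (hk : k ≠ 0) (m : ℕ →₀ ℕ) :
    expWord (single 0 k + embDomain succEmb m) = k :: expWord m := by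
  classical
  have h0 : (0 : ℕ) ∉ (embDomain succEmb m).support := by
    rw [notMem_support_iff, embDomain_succEmb_zero]
  have hs : (single 0 k + embDomain succEmb m).support =
      insert 0 (embDomain succEmb m).support := by
    ext i
    by_cases hi : i = 0
    · subst hi
      simp [hk]
    · rw [Finset.mem_insert, or_iff_right hi, mem_support_iff, mem_support_iff, Finsupp.add_apply,
        single_eq_of_ne hi, zero_add]
  rw [expWord, hs, Finset.sort_insert (· ≤ ·) (fun b _ => Nat.zero_le b) h0, List.map_cons,
    ← expWord_embDomain_succEmb m, expWord]
  congr 1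
  · simp [embDomain_succEmb_zero]
  · apply List.map_congr_left
    intro i hi
    rw [Finset.mem_sort] at hi
    rw [Finsupp.add_apply, single_eq_of_ne (by rintro rfl; exact h0 hi), zero_add]

variable {R : Type*} [CommRing R]

/-- The shift `x_i ↦ x_{i+1}` of power series. -/
noncomputable def shift : MvPowerSeries ℕ R →ₐ[R] MvPowerSeries ℕ R :=
  MvPowerSeries.rename succEmb

theorem coeff_shift_embDomain (p : MvPowerSeries ℕ R) (m : ℕ →₀ ℕ) :
    MvPowerSeries.coeff (embDomain succEmb m) (shift p) = MvPowerSeries.coeff m p :=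
  MvPowerSeries.coeff_embDomain_rename succEmb p m

theorem coeff_shift_of_ne_zero (p : MvPowerSeries ℕ R) {m : ℕ →₀ ℕ} (h : m 0 ≠ 0) :
    MvPowerSeries.coeff m (shift p) = 0 := by
  apply MvPowerSeries.coeff_rename_eq_zero
  rintro ⟨m', rfl⟩
  rw [← embDomain_eq_mapDomain] at h
  exact h (embDomain_succEmb_zero m')

/-- A monomial of `M_{a⬝α}` either avoids the first variable, or contains it with exponent exactly
`a`, the later variables then carrying `α`. -/
theorem monomialSeries_cons (a : ℕ+) (α : Comp) :
    monomialSeries R (a :: α) =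
      shift (monomialSeries R (a :: α)) +
        MvPowerSeries.X 0 ^ (a : ℕ) * shift (monomialSeries R α) := by
  classical
  ext m
  obtain ⟨m', hm⟩ := exists_eq_single_add_embDomain m
  generalize m 0 = k at hm
  subst hm
  rw [map_add, MvPowerSeries.X_pow_eq, MvPowerSeries.coeff_monomial_mul, one_mul]
  have ha := a.pos
  rcases Nat.eq_zero_or_pos k with rfl | hk
  · rw [single_zero, zero_add, coeff_shift_embDomain, if_neg, add_zero, coeff_monomialSeries,
      coeff_monomialSeries, expWord_embDomain_succEmb]
    intro hle
    have := hle 0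
    rw [embDomain_succEmb_zero, single_eq_same] at this
    omega
  · rw [coeff_shift_of_ne_zero _ (by simp; omega), zero_add, coeff_monomialSeries,
      expWord_single_add k hk.ne', List.map_cons]
    by_cases hka : k = a
    · subst hka
      rw [if_pos (le_add_right le_rfl), add_tsub_cancel_left, coeff_shift_embDomain,
        coeff_monomialSeries]
      simp
    -- The exponent `k` is positive and different from `a`. If `a ≤ k`, dividing by `x_0^a` leaves a
    -- positive power of `x_0`, which does not occur in a shifted series.
    · rw [if_neg (by simp [hka])]
      split_ifs with hle
      · have h1 := hle 0
        simp only [single_eq_same, Finsupp.add_apply, embDomain_succEmb_zero] at h1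
        rw [coeff_shift_of_ne_zero]
        simp only [tsub_apply, Finsupp.add_apply, single_eq_same, embDomain_succEmb_zero]
        omega
      · rfl

end Shift

/-! ### The operators on the first part and the quasi-shuffle recursion. -/

section Operators

variable {R : Type*} [CommRing R]

theorem M_nil : M R [] = 1 := Subtype.ext (monomialSeries_nil R)

/-- The linear map `M_β ↦ M_{a ⬝ β}`. -/
noncomputable def prepend (a : ℕ+) : QSym R →ₗ[R] QSym R :=
  (basisM R).constr R fun β => M R (a :: β)

/-- The linear map `M_{b ⬝ β} ↦ M_{(a + b) ⬝ β}` that kills constants. -/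
noncomputable def absorb (a : ℕ+) : QSym R →ₗ[R] QSym R :=
  (basisM R).constr R fun β => match β with
    | [] => 0
    | b :: β => M R ((a + b) :: β)

@[simp]
theorem prepend_M (a : ℕ+) (β : Comp) : prepend a (M R β) = M R (a :: β) := by
  rw [prepend, ← basisM_apply, Module.Basis.constr_basis]

@[simp]
theorem prepend_one (a : ℕ+) : prepend a (1 : QSym R) = M R [a] := by
  rw [← M_nil, prepend_M]

@[simp]
theorem absorb_one (a : ℕ+) : absorb a (1 : QSym R) = 0 := by
  rw [← M_nil, absorb, ← basisM_apply, Module.Basis.constr_basis]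

@[simp]
theorem absorb_M_cons (a b : ℕ+) (β : Comp) :
    absorb a (M R (b :: β)) = M R ((a + b) :: β) := by
  rw [absorb, ← basisM_apply, Module.Basis.constr_basis]

/-- Induction on the number of parts: linear maps that satisfy the same recursion are equal. -/
theorem linearMap_ext_rec {N : Type*} [AddCommGroup N] [Module R N] {f g : QSym R →ₗ[R] N}
    (h1 : f 1 = g 1) (h : ∀ b x, f x = g x → f (prepend b x) = g (prepend b x)) : f = g := by
  refine (basisM R).ext fun α => ?_
  rw [basisM_apply]
  induction α with
  | nil => rw [M_nil, h1]
  | cons a α ih => rw [← prepend_M, h a _ ih]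

@[simp]
theorem absorb_prepend (a b : ℕ+) (x : QSym R) :
    absorb a (prepend b x) = prepend (a + b) x := by
  suffices absorb a ∘ₗ prepend b = prepend (R := R) (a + b) from LinearMap.congr_fun this x
  refine (basisM R).ext fun α => ?_
  simp [basisM_apply]

theorem coe_prepend (a : ℕ+) (x : QSym R) :
    (prepend a x : MvPowerSeries ℕ R) =
      shift (prepend a x : MvPowerSeries ℕ R) +
        MvPowerSeries.X 0 ^ (a : ℕ) * shift (x : MvPowerSeries ℕ R) := by
  let V := (QSym R).val.toLinearMap
  suffices V ∘ₗ prepend a = shift.toLinearMap ∘ₗ V ∘ₗ prepend a +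
      LinearMap.mulLeft R (MvPowerSeries.X 0 ^ (a : ℕ)) ∘ₗ shift.toLinearMap ∘ₗ V from
    LinearMap.congr_fun this x
  refine (basisM R).ext fun α => ?_
  rw [basisM_apply]
  simp only [LinearMap.comp_apply, LinearMap.add_apply, prepend_M]
  exact monomialSeries_cons a α

/-- Constants are fixed by the shift, so `eq_zero_of_shift_eq` needs them excluded separately. -/
theorem constantCoeff_prepend (a : ℕ+) (x : QSym R) :
    MvPowerSeries.constantCoeff (prepend a x : MvPowerSeries ℕ R) = 0 := by
  let V := (QSym R).val.toLinearMap
  suffices MvPowerSeries.coeff (R := R) (0 : ℕ →₀ ℕ) ∘ₗ V ∘ₗ prepend a = 0 from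
    LinearMap.congr_fun this x
  refine (basisM R).ext fun α => ?_
  rw [basisM_apply]
  simp only [LinearMap.comp_apply, prepend_M]
  refine (coeff_monomialSeries (a :: α) 0).trans (if_neg ?_)
  simp [expWord]

/-- A quasisymmetric function without constant term that is fixed under the shift vanishes. -/
theorem eq_zero_of_shift_eq {x : QSym R} (h : shift (x : MvPowerSeries ℕ R) = x)
    (h0 : MvPowerSeries.constantCoeff (x : MvPowerSeries ℕ R) = 0) : x = 0 := by
  have key : ∀ α : Comp, MvPowerSeries.coeff (leadingExp α) (x : MvPowerSeries ℕ R) = 0 := by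
    intro α
    cases α with
    | nil =>
      have : leadingExp [] = 0 := by
        rw [← Finsupp.support_eq_empty, leadingExp_support]
        rfl
      rw [this]
      exact h0
    | cons a α =>
      rw [← h]
      apply coeff_shift_of_ne_zero
      rw [leadingExp_apply]
      simp
  apply (basisM R).repr.injective
  rw [map_zero]
  ext α
  let V := (QSym R).val.toLinearMap
  have : Finsupp.lapply α ∘ₗ (basisM R).repr.toLinearMap =
      MvPowerSeries.coeff (R := R) (leadingExp α) ∘ₗ V := by
    refine (basisM R).ext fun β => ?_
    simp only [LinearMap.comp_apply, LinearEquiv.coe_coe, Module.Basis.repr_self,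
      Finsupp.lapply_apply]
    rw [basisM_apply]
    refine Eq.trans ?_ (coeff_monomialSeries β (leadingExp α)).symm
    rw [expWord_leadingExp, Finsupp.single_apply]
    exact if_congr ⟨fun h => by rw [h], fun h => (map_coe_injective h).symm⟩ rfl rfl
  exact (LinearMap.congr_fun this x).trans (key α)

/-- The quasi-shuffle recursion. -/
theorem prepend_mul_prepend (a b : ℕ+) (x y : QSym R) :
    prepend a x * prepend b y =
      prepend a (x * prepend b y) + prepend b (prepend a x * y) + prepend (a + b) (x * y) := by
  rw [← sub_eq_zero]
  -- Expanding every `prepend` by `coe_prepend`, the terms containing the first variable agree on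
  -- both sides, so the difference of the two sides equals its own shift.
  apply eq_zero_of_shift_eq
  · simp only [Subalgebra.coe_sub, Subalgebra.coe_add, Subalgebra.coe_mul, map_sub, map_add,
      map_mul]
    have h1 := coe_prepend a x
    have h2 := coe_prepend b y
    have h3 := coe_prepend a (x * prepend b y)
    have h4 := coe_prepend b (prepend a x * y)
    have h5 := coe_prepend (a + b) (x * y)
    simp only [Subalgebra.coe_mul, map_mul, PNat.add_coe, pow_add] at h3 h4 h5
    generalize shift (prepend a x : MvPowerSeries ℕ R) = sx at *
    generalize shift (prepend b y : MvPowerSeries ℕ R) = sy at *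
    rw [h1, h2]
    linear_combination h3 + h4 + h5
  · simp only [Subalgebra.coe_sub, Subalgebra.coe_add, Subalgebra.coe_mul, map_sub, map_add,
      map_mul, constantCoeff_prepend]
    simp

end Operators
-- The recursions for the two halves of a product.
section ProductRule

variable {R : Type*} [CommRing R]

/-- A linear property of quasisymmetric functions that holds for `1` and on the range of each
`prepend b` holds everywhere. -/
theorem prepend_induction {p : QSym R → Prop} (x : QSym R) (one : p 1)
    (prepend : ∀ b x, p (prepend b x)) (add : ∀ x y, p x → p y → p (x + y))
    (smul : ∀ (c : R) x, p x → p (c • x)) : p x := by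
  have hx : x ∈ Submodule.span R (Set.range (M R)) := span_M R trivial
  induction hx using Submodule.span_induction with
  | mem x h =>
    obtain ⟨α, rfl⟩ := h
    cases α with
    | nil => exact M_nil (R := R) ▸ one
    | cons a α => exact prepend_M (R := R) a α ▸ prepend a (M R α)
  | zero => exact zero_smul R (1 : QSym R) ▸ smul 0 1 one
  | add x y _ _ hx hy => exact add x y hx hy
  | smul c x _ hx => exact smul c x hx

theorem absorb_absorb (a b : ℕ+) (x : QSym R) : absorb a (absorb b x) = absorb (a + b) x := by
  induction x using prepend_induction with
  | one => simp
  | prepend c x => simp [add_assoc]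
  | add x y hx hy => simp [hx, hy]
  | smul c x hx => simp [hx]

/-- The linear map `D_β ↦ D_{(a + b) ⬝ β'}` for `β = b ⬝ β'`, where `r` is the inverse of `q`. -/
noncomputable def merge (r : R) (a : ℕ+) : QSym R →ₗ[R] QSym R := r ^ (a : ℕ) • absorb a

/-- The linear map `D_β ↦ D_{a ⬝ β}`, where `r` is the inverse of `q`. -/
noncomputable def attach (q r t : R) (a : ℕ+) : QSym R →ₗ[R] QSym R :=
  (q * r ^ (a : ℕ)) • prepend a - t • merge r a

theorem merge_apply (r : R) (a : ℕ+) (x : QSym R) : merge r a x = r ^ (a : ℕ) • absorb a x := rfl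

theorem attach_apply (q r t : R) (a : ℕ+) (x : QSym R) :
    attach q r t a x = (q * r ^ (a : ℕ)) • prepend a x - (t * r ^ (a : ℕ)) • absorb a x := by
  rw [← smul_smul t]
  rfl

/-- Both terms of `attach` are compatible with absorption: `absorb a` turns `prepend b` into
`prepend (a + b)` and `absorb b` into `absorb (a + b)`, while the powers of `r` multiply. The factor
`q` is counted once, as only one part results. -/
theorem merge_attach (q r t : R) (a b : ℕ+) (x : QSym R) :
    merge r a (attach q r t b x) = attach q r t (a + b) x := by
  simp only [merge_apply, attach_apply, map_sub, map_smul, absorb_prepend, absorb_absorb,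
    PNat.add_coe, pow_add]
  module

/-- The half of the product `f * g` that collects the monomials whose first part comes from `g`
alone: the linear map `prepend b g ↦ prepend b (f * g)` that kills constants. -/
noncomputable def rightHalf (f : QSym R) : QSym R →ₗ[R] QSym R :=
  (basisM R).constr R fun β => match β with
    | [] => 0
    | b :: β => prepend b (f * M R β)

@[simp]
theorem rightHalf_one (f : QSym R) : rightHalf f 1 = 0 := by
  rw [← M_nil, rightHalf, ← basisM_apply, Module.Basis.constr_basis]

@[simp]
theorem rightHalf_prepend (f : QSym R) (b : ℕ+) (g : QSym R) :
    rightHalf f (prepend b g) = prepend b (f * g) := by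
  suffices rightHalf f ∘ₗ prepend b = prepend b ∘ₗ LinearMap.mulLeft R f from
    LinearMap.congr_fun this g
  refine (basisM R).ext fun α => ?_
  rw [basisM_apply]
  simp only [LinearMap.comp_apply, prepend_M, LinearMap.mulLeft_apply]
  rw [rightHalf, ← basisM_apply R (b :: α), Module.Basis.constr_basis]

theorem rightHalf_add (f f' g : QSym R) :
    rightHalf (f + f') g = rightHalf f g + rightHalf f' g := by
  induction g using prepend_induction with
  | one => simp
  | prepend b x => simp [add_mul]
  | add x y hx hy => rw [map_add, hx, hy, map_add, map_add]; abel
  | smul c x hx => simp [hx]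

theorem rightHalf_smul (c : R) (f g : QSym R) : rightHalf (c • f) g = c • rightHalf f g := by
  induction g using prepend_induction with
  | one => simp
  | prepend b x => simp
  | add x y hx hy => rw [map_add, hx, hy, map_add, smul_add]
  | smul d x hx => rw [map_smul, hx, map_smul, smul_comm]

/-- `rightHalf 1` only removes the constant term, which `absorb` kills anyway. -/
theorem merge_rightHalf_one_left (b : ℕ+) (g : QSym R) (r : R) :
    merge r b (rightHalf 1 g) = merge r b g := by
  induction g using prepend_induction with
  | one => simp [merge_apply]
  | prepend c x => simp
  | add x y hx hy => simp [hx, hy]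
  | smul d x hx => simp [hx]

/-- `rightHalf f` commutes with `absorb b`, and carries `prepend b g` to `prepend b (f * g)`. Hence
the only discrepancy with `attach b (f * g)` is that the `absorb` term sees `rightHalf f g` instead
of `f * g`. -/
theorem rightHalf_attach (q r t : R) (f : QSym R) (b : ℕ+) (g : QSym R) :
    rightHalf f (attach q r t b g) =
      attach q r t b (f * g) + t • merge r b (f * g - rightHalf f g) := by
  induction g using prepend_induction with
  | one =>
    simp only [attach_apply, merge_apply, mul_one, map_smul, rightHalf_one,
      rightHalf_prepend, absorb_one, smul_zero, sub_zero]
    module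
  | prepend c x =>
    simp only [attach_apply, merge_apply, map_sub, map_smul, rightHalf_prepend, absorb_prepend]
    module
  | add x y hx hy =>
    simp only [mul_add, map_add, map_sub, smul_add, smul_sub] at hx hy ⊢
    rw [hx, hy]
    abel
  | smul d x hx =>
    have := congrArg (d • ·) hx
    simp only [mul_smul_comm, map_smul, map_sub, smul_sub, smul_add] at this ⊢
    rw [this]
    module

/-- The weight `q + t` has two sources. For `g = prepend d y`, the overlap term of the quasi-shuffle
contributes `q r^a prepend (a + d) (f * y)`. The `absorb` term of `attach a (f * g)` contains `-t
r^a prepend (a + d) (f * y)`, which has no counterpart on the left and must be compensated. -/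
theorem attach_mul_sub_rightHalf (q r t : R) (f : QSym R) (a : ℕ+) (g : QSym R) :
    attach q r t a f * g - rightHalf (attach q r t a f) g =
      attach q r t a (f * g) + (q + t) • merge r a (rightHalf f g) := by
  induction g using prepend_induction with
  | one => simp
  | prepend d y =>
    -- The first part of `f` has to be exposed as well, because `attach a f` contains `absorb a f`.
    induction f using prepend_induction with
    | one =>
      simp only [attach_apply, merge_apply, one_mul, absorb_one, smul_zero, sub_zero,
        rightHalf_prepend, absorb_prepend, smul_mul_assoc, map_smul, prepend_mul_prepend]
      module
    | prepend c x =>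
      simp only [attach_apply, merge_apply, map_sub, map_add, map_smul, rightHalf_prepend,
        absorb_prepend, sub_mul, smul_mul_assoc, prepend_mul_prepend, smul_add, add_assoc]
      module
    | add x y hx hy =>
      simp only [add_mul, map_add, rightHalf_add, smul_add] at hx hy ⊢
      linear_combination (exp := 1) hx + hy
    | smul c x hx =>
      have := congrArg (c • ·) hx
      simp only [smul_mul_assoc, map_smul, rightHalf_smul, smul_sub, smul_add] at this ⊢
      rw [this]
      module
  | add x y hx hy =>
    simp only [mul_add, map_add, smul_add] at hx hy ⊢
    linear_combination (exp := 1) hx + hy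
  | smul d x hx =>
    have := congrArg (d • ·) hx
    simp only [mul_smul_comm, map_smul, smul_sub, smul_add] at this ⊢
    rw [this]
    module

/-! ### Weighted sums over words with separators, and their comparison with products. -/

/-- The functions `D_α`, built by attaching the parts one by one. -/
noncomputable def attachAll (q r t : R) : Comp → QSym R
  | [] => 1
  | a :: α => attach q r t a (attachAll q r t α)

/-- The contribution of an expression `γ` to the right-hand side of the product rule. -/
noncomputable def weighted (q r t : R) (γ : Expression) : QSym R :=
  ((q + t) ^ c1 γ * t ^ c2 γ) • attachAll q r t (plus γ)

/-- The total contribution of the expressions with underlying word `w`. -/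
noncomputable def wordSum (q r t : R) (w : List Letter) : QSym R :=
  ((separate w).map (weighted q r t)).sum

theorem plus_cons_ne_nil (x : Letter × Sep) (γ : Expression) : plus (x :: γ) ≠ [] := by
  obtain ⟨x, s⟩ := x
  cases s
  · simp [plus]
  all_goals
    simp only [plus]
    split <;> simp

theorem merge_attachAll_cons (q r t : R) (a b : ℕ+) (β : Comp) :
    merge r a (attachAll q r t (b :: β)) = attachAll q r t ((a + b) :: β) :=
  merge_attach q r t a b _

theorem weighted_comma (q r t : R) (x : Letter) (γ : Expression) :
    weighted q r t ((x, Sep.comma) :: γ) = attach q r t x.val (weighted q r t γ) := by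
  simp [weighted, c1, c2, plus, attachAll]

/-- The nonempty tail supplies the part to which `x` is added; that part exists whatever the
separators in the tail are. -/
theorem weighted_plus1 (q r t : R) (x : Letter) (y : Letter × Sep) (γ : Expression) :
    weighted q r t ((x, Sep.plus1) :: y :: γ) =
      (q + t) • merge r x.val (weighted q r t (y :: γ)) := by
  obtain ⟨b, β, h⟩ := List.exists_cons_of_ne_nil (plus_cons_ne_nil y γ)
  have hp : plus ((x, Sep.plus1) :: y :: γ) = (x.val + b) :: β := by
    rw [plus, h]
    simp
  have h1 : c1 ((x, Sep.plus1) :: y :: γ) = c1 (y :: γ) + 1 := by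
    rw [c1, List.countP_cons_of_pos (by simp), c1]
  have h2 : c2 ((x, Sep.plus1) :: y :: γ) = c2 (y :: γ) := by
    rw [c2, List.countP_cons_of_neg (by simp), c2]
  rw [weighted, weighted, hp, h, map_smul, merge_attachAll_cons, smul_smul, h1, h2]
  congr 1
  ring

theorem weighted_plus2 (q r t : R) (x : Letter) (y : Letter × Sep) (γ : Expression) :
    weighted q r t ((x, Sep.plus2) :: y :: γ) =
      t • merge r x.val (weighted q r t (y :: γ)) := by
  obtain ⟨b, β, h⟩ := List.exists_cons_of_ne_nil (plus_cons_ne_nil y γ)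
  have hp : plus ((x, Sep.plus2) :: y :: γ) = (x.val + b) :: β := by
    rw [plus, h]
    simp
  have h1 : c1 ((x, Sep.plus2) :: y :: γ) = c1 (y :: γ) := by
    rw [c1, List.countP_cons_of_neg (by simp), c1]
  have h2 : c2 ((x, Sep.plus2) :: y :: γ) = c2 (y :: γ) + 1 := by
    rw [c2, List.countP_cons_of_pos (by simp), c2]
  rw [weighted, weighted, hp, h, map_smul, merge_attachAll_cons, smul_smul, h1, h2]
  congr 1
  ring

theorem exists_cons_of_mem_separate {y : Letter} {w : List Letter} {γ : Expression}
    (h : γ ∈ separate (y :: w)) : ∃ z δ, γ = z :: δ := by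
  cases γ with
  | nil => simpa using (mem_separate.1 h).1
  | cons z δ => exact ⟨z, δ, rfl⟩

theorem wordSum_nil (q r t : R) : wordSum q r t [] = 1 := by
  simp [wordSum, separate, weighted, c1, c2, plus, attachAll]

theorem wordSum_singleton (q r t : R) (x : Letter) :
    wordSum q r t [x] = attach q r t x.val (wordSum q r t []) := by
  rw [wordSum, wordSum]
  simp [separate, weighted_comma]

/-- The sum over the expressions of a word whose first separator is fixed. -/
theorem sum_map_separate_cons {q r t : R} {x y : Letter} {w : List Letter} {s : Sep}
    {φ : QSym R →ₗ[R] QSym R}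
    (h : ∀ z γ, weighted q r t ((x, s) :: z :: γ) = φ (weighted q r t (z :: γ))) :
    (((separate (y :: w)).map ((x, s) :: ·)).map (weighted q r t)).sum =
      φ (wordSum q r t (y :: w)) := by
  rw [wordSum, map_list_sum, List.map_map, List.map_map]
  congr 1
  apply List.map_congr_left
  intro γ hγ
  obtain ⟨z, δ, rfl⟩ := exists_cons_of_mem_separate hγ
  exact h z δ

theorem sum_map_separate_comma (q r t : R) (x y : Letter) (w : List Letter) :
    (((separate (y :: w)).map ((x, Sep.comma) :: ·)).map (weighted q r t)).sum =
      attach q r t x.val (wordSum q r t (y :: w)) :=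
  sum_map_separate_cons fun _ _ => weighted_comma ..

theorem sum_map_separate_plus1 (q r t : R) (x y : Letter) (w : List Letter) :
    (((separate (y :: w)).map ((x, Sep.plus1) :: ·)).map (weighted q r t)).sum =
      (q + t) • merge r x.val (wordSum q r t (y :: w)) :=
  sum_map_separate_cons (φ := (q + t) • merge r x.val) fun _ _ => weighted_plus1 ..

theorem sum_map_separate_plus2 (q r t : R) (x y : Letter) (w : List Letter) :
    (((separate (y :: w)).map ((x, Sep.plus2) :: ·)).map (weighted q r t)).sum =
      t • merge r x.val (wordSum q r t (y :: w)) :=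
  sum_map_separate_cons (φ := t • merge r x.val) fun _ _ => weighted_plus2 ..

/-- `wordSum` restricted to the words that start with a letter from the right factor. -/
noncomputable def wordSumRight (q r t : R) : List Letter → QSym R
  | Sum.inr b :: w => wordSum q r t (Sum.inr b :: w)
  | _ => 0

/-- A left letter may be followed by `+₁` only when the next letter is a right one, so the
correction sees only `wordSumRight`. This is the word form of `attach_mul_sub_rightHalf`. -/
theorem wordSum_inl_cons (q r t : R) (a : ℕ+) (w : List Letter) :
    wordSum q r t (Sum.inl a :: w) =
      attach q r t a (wordSum q r t w) + (q + t) • merge r a (wordSumRight q r t w) := by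
  match w with
  | [] =>
    rw [wordSum_singleton, wordSumRight, map_zero, smul_zero, add_zero, Letter.val]
    simp
  | Sum.inl b :: w =>
    rw [wordSum, separate]
    simp only [allowedSeps, List.flatMap_cons, List.flatMap_nil, List.append_nil]
    rw [sum_map_separate_comma, wordSumRight, map_zero, smul_zero, add_zero, Letter.val]
    simp
  | Sum.inr b :: w =>
    rw [wordSum, separate]
    simp only [allowedSeps, List.flatMap_cons, List.flatMap_nil, List.append_nil, List.map_append,
      List.sum_append]
    rw [sum_map_separate_comma, sum_map_separate_plus1, wordSumRight, Letter.val]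

/-- The word form of `rightHalf_attach`: the difference selects the words starting with a left
letter. For the empty word it equals `1` instead of `0`, which is harmless because `merge` kills
constants. -/
theorem wordSum_inr_cons (q r t : R) (b : ℕ+) (w : List Letter) :
    wordSum q r t (Sum.inr b :: w) =
      attach q r t b (wordSum q r t w) +
        t • merge r b (wordSum q r t w - wordSumRight q r t w) := by
  match w with
  | [] =>
    rw [wordSum_singleton, wordSumRight, sub_zero, wordSum_nil, merge_apply, absorb_one, smul_zero,
      smul_zero, add_zero, Letter.val]
    simp
  | Sum.inr a :: w =>
    rw [wordSum, separate]
    simp only [allowedSeps, List.flatMap_cons, List.flatMap_nil, List.append_nil]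
    rw [sum_map_separate_comma, wordSumRight, sub_self, map_zero, smul_zero, add_zero, Letter.val]
  | Sum.inl a :: w =>
    rw [wordSum, separate]
    simp only [allowedSeps, List.flatMap_cons, List.flatMap_nil, List.append_nil, List.map_append,
      List.sum_append]
    rw [sum_map_separate_comma, sum_map_separate_plus2, wordSumRight, Letter.val, sub_zero]
    simp

theorem sum_wordSum_inl_cons (q r t : R) (a : ℕ+) (l : List (List Letter)) :
    (l.map fun w => wordSum q r t (Sum.inl a :: w)).sum =
      attach q r t a (l.map (wordSum q r t)).sum +
        (q + t) • merge r a (l.map (wordSumRight q r t)).sum := by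
  induction l with
  | nil => simp
  | cons w l ih =>
    rw [List.map_cons, List.sum_cons, ih, wordSum_inl_cons]
    simp only [List.map_cons, List.sum_cons, map_add, smul_add]
    abel

theorem sum_wordSum_inr_cons (q r t : R) (b : ℕ+) (l : List (List Letter)) :
    (l.map fun w => wordSum q r t (Sum.inr b :: w)).sum =
      attach q r t b (l.map (wordSum q r t)).sum +
        t • merge r b ((l.map (wordSum q r t)).sum - (l.map (wordSumRight q r t)).sum) := by
  induction l with
  | nil => simp
  | cons w l ih =>
    rw [List.map_cons, List.sum_cons, ih, wordSum_inr_cons]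
    simp only [List.map_cons, List.sum_cons, map_add, map_sub, smul_add, smul_sub]
    abel

theorem wordSum_map_inl (q r t : R) (α : Comp) :
    wordSum q r t (α.map Sum.inl) = attachAll q r t α ∧
      wordSumRight q r t (α.map Sum.inl) = 0 := by
  induction α with
  | nil => exact ⟨wordSum_nil q r t, rfl⟩
  | cons a α ih =>
    refine ⟨?_, rfl⟩
    rw [List.map_cons, wordSum_inl_cons, ih.1, ih.2, map_zero, smul_zero, add_zero]
    rfl

theorem wordSum_map_inr (q r t : R) (β : Comp) :
    wordSum q r t (β.map Sum.inr) = attachAll q r t β ∧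
      wordSumRight q r t (β.map Sum.inr) = rightHalf 1 (attachAll q r t β) := by
  induction β with
  | nil => exact ⟨wordSum_nil q r t, (rightHalf_one 1).symm⟩
  | cons b β ih =>
    have h : wordSum q r t ((b :: β).map Sum.inr) = attachAll q r t (b :: β) := by
      rw [List.map_cons, wordSum_inr_cons, ih.1, ih.2, map_sub, merge_rightHalf_one_left, sub_self,
        smul_zero, add_zero]
      rfl
    refine ⟨h, ?_⟩
    refine Eq.trans h ?_
    rw [attachAll, rightHalf_attach, one_mul, map_sub, merge_rightHalf_one_left, sub_self,
        smul_zero, add_zero]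

/-- The two statements are proved together: each recursion for one half of the product involves the
other half. -/
theorem sum_shuffleList (q r t : R) (α β : Comp) :
    ((shuffleList α β).map (wordSum q r t)).sum = attachAll q r t α * attachAll q r t β ∧
      ((shuffleList α β).map (wordSumRight q r t)).sum =
        rightHalf (attachAll q r t α) (attachAll q r t β) := by
  induction α, β using shuffleList.induct with
  | case1 β =>
    rw [shuffleList, attachAll, one_mul]
    simpa using wordSum_map_inr q r t β
  | case2 a α =>
    rw [shuffleList, attachAll.eq_1, mul_one, rightHalf_one]
    simpa only [List.map_cons, List.map_nil, List.sum_cons, List.sum_nil, add_zero] using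
      wordSum_map_inl q r t (a :: α)
  | case3 a α b β ih1 ih2 =>
    -- Of the two families in the shuffle recursion, only the words starting with `b` survive in
    -- `wordSumRight`.
    have hR : ((shuffleList (a :: α) (b :: β)).map (wordSumRight q r t)).sum =
        ((shuffleList (a :: α) β).map fun w => wordSum q r t (Sum.inr b :: w)).sum := by
      rw [shuffleList, List.map_append, List.sum_append, List.map_map, List.map_map]
      have h0 : ((shuffleList α (b :: β)).map (wordSumRight q r t ∘ (Sum.inl a :: ·))).sum = 0 :=
        List.sum_eq_zero (by
          intro x hx
          rw [List.mem_map] at hx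
          obtain ⟨w, -, rfl⟩ := hx
          rfl)
      rw [h0, zero_add]
      rfl
    have hR' : ((shuffleList (a :: α) (b :: β)).map (wordSumRight q r t)).sum =
        rightHalf (attachAll q r t (a :: α)) (attachAll q r t (b :: β)) := by
      rw [hR, sum_wordSum_inr_cons, ih2.1, ih2.2, attachAll.eq_2 q r t b β, rightHalf_attach]
    refine ⟨?_, hR'⟩
    -- The remaining half of the product is the sum over the shuffles starting with `a`.
    have hL := attach_mul_sub_rightHalf q r t (attachAll q r t α) a (attachAll q r t (b :: β))
    rw [← ih1.1, ← ih1.2, ← sum_wordSum_inl_cons, sub_eq_iff_eq_add] at hL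
    rw [attachAll.eq_2 q r t a α, hL, ← attachAll.eq_2 q r t a α, ← hR', hR, shuffleList,
      List.map_append, List.sum_append, List.map_map, List.map_map]
    rfl

theorem nodup_shuffleList (α β : Comp) : (shuffleList α β).Nodup := by
  induction α, β using shuffleList.induct with
  | case1 β => simp [shuffleList]
  | case2 a α => simp [shuffleList]
  | case3 a α b β ih1 ih2 =>
    rw [shuffleList]
    refine List.Nodup.append (ih1.map (List.cons_injective))
      (ih2.map (List.cons_injective)) ?_
    intro w h1 h2
    rw [List.mem_map] at h1 h2
    obtain ⟨v, -, rfl⟩ := h1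
    obtain ⟨v', -, h⟩ := h2
    simp at h

theorem nodup_separate (w : List Letter) : (separate w).Nodup := by
  induction w using separate.induct with
  | case1 => simp [separate]
  | case2 x => simp [separate]
  | case3 x y w ih =>
    rw [separate, List.nodup_flatMap]
    refine ⟨fun s _ => ih.map List.cons_injective, ?_⟩
    have hs : (allowedSeps x y).Nodup := by
      cases x <;> cases y <;> simp [allowedSeps]
    refine hs.imp fun {s s'} hne γ h1 h2 => ?_
    rw [List.mem_map] at h1 h2
    obtain ⟨v, -, rfl⟩ := h1
    obtain ⟨v', -, h⟩ := h2
    simp only [List.cons.injEq, Prod.mk.injEq, true_and] at h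
    exact hne h.1.symm

/-- Without repetitions, the sum over the finite set `twoWayShuffles` is a list sum. Different words
give disjoint lists, as an expression determines its word. -/
theorem nodup_flatMap_separate (α β : Comp) : ((shuffleList α β).flatMap separate).Nodup := by
  rw [List.nodup_flatMap]
  refine ⟨fun w _ => nodup_separate w, ?_⟩
  refine (nodup_shuffleList α β).imp fun {w w'} hne γ h1 h2 => hne ?_
  rw [← (mem_separate.1 h1).1, ← (mem_separate.1 h2).1]

theorem sum_twoWayShuffles (q r t : R) (α β : Comp) :
    ∑ γ ∈ twoWayShuffles α β, weighted q r t γ = attachAll q r t α * attachAll q r t β := by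
  rw [← (sum_shuffleList q r t α β).1, twoWayShuffles,
    List.sum_toFinset _ (nodup_flatMap_separate α β)]
  induction shuffleList α β with
  | nil => simp
  | cons w l ih => simp [ih, wordSum]

end ProductRule
-- The coproduct rule.
section Coproduct

variable {R : Type*} [CommRing R]

theorem sum_deconcatenations_nil {N : Type*} [AddCommMonoid N] (F : Comp × Comp → N) :
    ∑ p ∈ deconcatenations [], F p = F ([], []) := by
  simp [deconcatenations]

theorem sum_deconcatenations_cons {N : Type*} [AddCommMonoid N] (F : Comp × Comp → N) (a : ℕ+)
    (γ : Comp) :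
    ∑ p ∈ deconcatenations (a :: γ), F p =
      F ([], a :: γ) + ∑ p ∈ deconcatenations γ, F (a :: p.1, p.2) := by
  have h : deconcatenations (a :: γ) =
      insert ([], a :: γ) ((deconcatenations γ).image fun p => (a :: p.1, p.2)) := by
    ext ⟨u, v⟩
    simp only [Finset.mem_insert, Finset.mem_image, mem_deconcatenations, Prod.mk.injEq,
      Prod.exists]
    cases u with
    | nil => simp
    | cons c u => simp; tauto
  rw [h, Finset.sum_insert (by simp), Finset.sum_image]
  intro p _ p' _ hp
  simp only [Prod.mk.injEq, List.cons.injEq, true_and] at hp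
  exact Prod.ext hp.1 hp.2

theorem coproduct_one : coproduct R (1 : QSym R) = 1 ⊗ₜ 1 := by
  rw [← M_nil, coproduct_M, sum_deconcatenations_nil]

theorem coproduct_prepend (a : ℕ+) (x : QSym R) :
    coproduct R (prepend a x) = 1 ⊗ₜ prepend a x + (prepend a).rTensor (QSym R) (coproduct R x) := by
  suffices coproduct R ∘ₗ prepend a =
      TensorProduct.mk R (QSym R) (QSym R) 1 ∘ₗ prepend a +
        (prepend a).rTensor (QSym R) ∘ₗ coproduct R from LinearMap.congr_fun this x
  refine (basisM R).ext fun α => ?_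
  simp only [basisM_apply, LinearMap.comp_apply, LinearMap.add_apply, prepend_M, coproduct_M,
    sum_deconcatenations_cons, map_sum, LinearMap.rTensor_tmul, TensorProduct.mk_apply, M_nil]

/-- The first part lies in the left tensor factor unless that factor is `1`. In that case `absorb a`
on the left gives zero, and the separate summand `1 ⊗ absorb a x` takes over. -/
theorem coproduct_absorb (a : ℕ+) (x : QSym R) :
    coproduct R (absorb a x) = 1 ⊗ₜ absorb a x + (absorb a).rTensor (QSym R) (coproduct R x) := by
  induction x using prepend_induction with
  | one => simp [coproduct_one]
  | prepend b x =>
    rw [absorb_prepend, coproduct_prepend, coproduct_prepend, map_add, LinearMap.rTensor_tmul,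
      absorb_one, TensorProduct.zero_tmul, zero_add, ← LinearMap.rTensor_comp_apply]
    congr 3
    exact LinearMap.ext fun y => (absorb_prepend a b y).symm
  | add x y hx hy =>
    simp only [map_add, hx, hy, TensorProduct.tmul_add]
    abel
  | smul c x hx => simp only [map_smul, hx, TensorProduct.tmul_smul, smul_add]

theorem coproduct_attach (q r t : R) (a : ℕ+) (x : QSym R) :
    coproduct R (attach q r t a x) =
      1 ⊗ₜ attach q r t a x + (attach q r t a).rTensor (QSym R) (coproduct R x) := by
  have h (z : QSym R ⊗[R] QSym R) : (attach q r t a).rTensor (QSym R) z =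
      (q * r ^ (a : ℕ)) • (prepend a).rTensor (QSym R) z -
        (t * r ^ (a : ℕ)) • (absorb a).rTensor (QSym R) z := by
    have e : attach q r t a = (q * r ^ (a : ℕ)) • prepend a - (t * r ^ (a : ℕ)) • absorb a :=
      LinearMap.ext fun y => attach_apply q r t a y
    rw [e, LinearMap.rTensor_sub, LinearMap.rTensor_smul, LinearMap.rTensor_smul]
    rfl
  rw [h, attach_apply, map_sub, map_smul, map_smul, coproduct_prepend, coproduct_absorb,
    TensorProduct.tmul_sub, TensorProduct.tmul_smul, TensorProduct.tmul_smul]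
  module

theorem coproduct_attachAll (q r t : R) (γ : Comp) :
    coproduct R (attachAll q r t γ) =
      ∑ p ∈ deconcatenations γ, attachAll q r t p.1 ⊗ₜ[R] attachAll q r t p.2 := by
  induction γ with
  | nil => rw [sum_deconcatenations_nil, attachAll, coproduct_one]
  | cons a γ ih =>
    rw [sum_deconcatenations_cons, attachAll.eq_2, coproduct_attach, ih, map_sum]
    simp only [LinearMap.rTensor_tmul, attachAll]

end Coproduct

/-! ### Inverting the map `M_α ↦ D_α`. -/

section Basis

variable {R : Type*} [CommRing R]

/-- The linear map `M_α ↦ D_α`. -/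
noncomputable def toAttachAll (q r t : R) : QSym R →ₗ[R] QSym R :=
  (basisM R).constr R (attachAll q r t)

theorem toAttachAll_M (q r t : R) (α : Comp) :
    toAttachAll q r t (M R α) = attachAll q r t α := by
  rw [toAttachAll, ← basisM_apply, Module.Basis.constr_basis]

theorem toAttachAll_one (q r t : R) : toAttachAll q r t 1 = 1 := by
  rw [← M_nil, toAttachAll_M, attachAll, M_nil]

theorem toAttachAll_prepend (q r t : R) (a : ℕ+) (x : QSym R) :
    toAttachAll q r t (prepend a x) = attach q r t a (toAttachAll q r t x) := by
  suffices toAttachAll q r t ∘ₗ prepend a = attach q r t a ∘ₗ toAttachAll q r t from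
    LinearMap.congr_fun this x
  refine (basisM R).ext fun α => ?_
  simp only [basisM_apply, LinearMap.comp_apply, prepend_M, toAttachAll_M, attachAll]

theorem toAttachAll_absorb (q r t : R) (a : ℕ+) (x : QSym R) :
    toAttachAll q r t (absorb a x) = merge r a (toAttachAll q r t x) := by
  induction x using prepend_induction with
  | one => simp [toAttachAll_one, merge_apply]
  | prepend b x => rw [absorb_prepend, toAttachAll_prepend, toAttachAll_prepend, merge_attach]
  | add x y hx hy => simp only [map_add, hx, hy]
  | smul c x hx => simp only [map_smul, hx]

/-- The coordinates of the monomial quasisymmetric functions in the `D_α`, read in the basis of the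
`M_α`. -/
noncomputable def inverseAttachAll (q r t : R) : Comp → QSym R
  | [] => 1
  | a :: α => (r * q ^ (a : ℕ)) • (prepend a (inverseAttachAll q r t α) +
      t • absorb a (inverseAttachAll q r t α))

/-- The inverse of the linear map `M_α ↦ D_α`. -/
noncomputable def ofAttachAll (q r t : R) : QSym R →ₗ[R] QSym R :=
  (basisM R).constr R (inverseAttachAll q r t)

theorem ofAttachAll_M (q r t : R) (α : Comp) :
    ofAttachAll q r t (M R α) = inverseAttachAll q r t α := by
  rw [ofAttachAll, ← basisM_apply, Module.Basis.constr_basis]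

theorem ofAttachAll_one (q r t : R) : ofAttachAll q r t 1 = 1 := by
  rw [← M_nil, ofAttachAll_M, inverseAttachAll, M_nil]

theorem ofAttachAll_prepend (q r t : R) (a : ℕ+) (x : QSym R) :
    ofAttachAll q r t (prepend a x) =
      (r * q ^ (a : ℕ)) • (prepend a (ofAttachAll q r t x) + t • absorb a (ofAttachAll q r t x)) := by
  suffices ofAttachAll q r t ∘ₗ prepend a =
      ((r * q ^ (a : ℕ)) • (prepend a + t • absorb a)) ∘ₗ ofAttachAll q r t from
    LinearMap.congr_fun this x
  refine (basisM R).ext fun α => ?_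
  simp only [basisM_apply, LinearMap.comp_apply, prepend_M, ofAttachAll_M, inverseAttachAll,
    LinearMap.smul_apply, LinearMap.add_apply]

/-- `toAttachAll` turns `absorb a` into `r^a absorb a`, so its inverse must produce the factor
`q^a`. -/
theorem ofAttachAll_absorb (q r t : R) (a : ℕ+) (x : QSym R) :
    ofAttachAll q r t (absorb a x) = q ^ (a : ℕ) • absorb a (ofAttachAll q r t x) := by
  induction x using prepend_induction with
  | one => simp [ofAttachAll_one]
  | prepend b x =>
    simp only [absorb_prepend, ofAttachAll_prepend, map_smul, map_add, absorb_absorb,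
      PNat.add_coe, pow_add]
    module
  | add x y hx hy => simp only [map_add, hx, hy, smul_add]
  | smul c x hx => rw [map_smul, map_smul, hx, map_smul, map_smul, smul_comm]

theorem toAttachAll_comp_ofAttachAll {q r : R} (h : q * r = 1) (t : R) :
    toAttachAll q r t ∘ₗ ofAttachAll q r t = LinearMap.id := by
  refine linearMap_ext_rec (by simp [ofAttachAll_one, toAttachAll_one]) fun a x hx => ?_
  rw [LinearMap.comp_apply, LinearMap.id_apply] at hx ⊢
  -- The added `t • absorb` term becomes `t • merge` and cancels the subtracted term of `attach`,
  -- leaving `prepend a x` with the scalar `(q r)^(a+1)`.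
  rw [ofAttachAll_prepend, map_smul, map_add, map_smul, toAttachAll_prepend, toAttachAll_absorb, hx,
    attach_apply, merge_apply, smul_smul, sub_add_cancel, smul_smul]
  have : r * q ^ (a : ℕ) * (q * r ^ (a : ℕ)) = (q * r) * (q * r) ^ (a : ℕ) := by ring
  rw [this, h, one_pow, one_mul, one_smul]

theorem ofAttachAll_comp_toAttachAll {q r : R} (h : q * r = 1) (t : R) :
    ofAttachAll q r t ∘ₗ toAttachAll q r t = LinearMap.id := by
  refine linearMap_ext_rec (by simp [ofAttachAll_one, toAttachAll_one]) fun a x hx => ?_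
  rw [LinearMap.comp_apply, LinearMap.id_apply] at hx ⊢
  rw [toAttachAll_prepend, attach_apply, map_sub, map_smul, map_smul, ofAttachAll_prepend,
    ofAttachAll_absorb, hx, smul_smul, smul_smul]
  have h1 : q * r ^ (a : ℕ) * (r * q ^ (a : ℕ)) = 1 := by
    rw [show q * r ^ (a : ℕ) * (r * q ^ (a : ℕ)) = (q * r) * (q * r) ^ (a : ℕ) by ring, h, one_pow,
      one_mul]
  have h2 : t * r ^ (a : ℕ) * q ^ (a : ℕ) = t := by
    rw [show t * r ^ (a : ℕ) * q ^ (a : ℕ) = t * (q * r) ^ (a : ℕ) by ring, h, one_pow, mul_one]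
  rw [h1, h2, one_smul, add_sub_cancel_right]

/-- The basis of the functions `D_α`. -/
noncomputable def basisAttachAll {q r : R} (h : q * r = 1) (t : R) :
    Module.Basis Comp R (QSym R) :=
  (basisM R).map (LinearEquiv.ofLinearMap (toAttachAll q r t) (ofAttachAll q r t)
    (toAttachAll_comp_ofAttachAll h t) (ofAttachAll_comp_toAttachAll h t))

theorem basisAttachAll_apply {q r : R} (h : q * r = 1) (t : R) (α : Comp) :
    basisAttachAll h t α = attachAll q r t α := by
  rw [basisAttachAll, Module.Basis.map_apply, basisM_apply]
  exact toAttachAll_M q r t α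

end Basis

/-! ### Agreement of the recursive construction with the definition of `D_α` as a sum over
coarsenings. -/

section Identification

theorem nodup_coarseningList (α : Comp) : (coarseningList α).Nodup := by
  induction α with
  | nil => simp [coarseningList]
  | cons a α ih =>
    -- A coarsening of `a :: α` reveals which coarsening of `α` it comes from: its first part equals
    -- `a` exactly when no fusion took place.
    have ne : ∀ b : ℕ+, a ≠ a + b := fun b h => by
      have := congrArg PNat.val h
      have hb := b.pos
      simp only [PNat.add_coe] at this
      omega
    rw [coarseningList, List.nodup_flatMap]
    constructor
    · intro β _
      cases β with
      | nil => simp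
      | cons b β => simp [ne]
    · refine ih.imp fun {β β'} hne γ h1 h2 => hne ?_
      cases β <;> cases β' <;> simp only [List.mem_cons, List.not_mem_nil, or_false] at h1 h2 <;>
        rcases h1 with rfl | rfl <;> simp_all [(ne _).symm]

/-- The coefficient of `M_β` in `D_α`. -/
noncomputable def coeffD (α β : Comp) : Cqt :=
  q ^ ((β.length : ℤ) - (size α : ℤ)) * (-t) ^ ((α.length : ℤ) - (β.length : ℤ))

theorem q_ne_zero : q ≠ 0 := by
  rw [q, Ne, IsFractionRing.to_map_eq_zero_iff]
  exact MvPolynomial.X_ne_zero 0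

theorem t_ne_zero : t ≠ 0 := by
  rw [t, Ne, IsFractionRing.to_map_eq_zero_iff]
  exact MvPolynomial.X_ne_zero 1

theorem q_zpow_step (a : ℕ+) (m n : ℤ) :
    q ^ (m + 1 - ((a : ℕ) + n)) = q * q⁻¹ ^ (a : ℕ) * q ^ (m - n) := by
  rw [show m + 1 - (((a : ℕ) : ℤ) + n) = 1 + -((a : ℕ) : ℤ) + (m - n) by ring,
    zpow_add₀ q_ne_zero, zpow_add₀ q_ne_zero, zpow_one, zpow_neg, zpow_natCast, inv_pow]

theorem coeffD_cons_cons (a : ℕ+) (α β : Comp) (c : ℕ+) :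
    coeffD (a :: α) (c :: β) = q * q⁻¹ ^ (a : ℕ) * coeffD α β := by
  simp only [coeffD, size, List.map_cons, List.sum_cons, List.length_cons, Nat.cast_add,
    Nat.cast_one]
  rw [q_zpow_step, add_sub_add_right_eq_sub, mul_assoc]

/-- The coefficient depends only on two lengths and one size. Under fusion `ℓ(β)` is unchanged while
`|α|` grows by `a` and `ℓ(α)` by one, which gives the factor `-t q^{-a}`. -/
theorem coeffD_cons_merge (a : ℕ+) (α β : Comp) (b c : ℕ+) :
    coeffD (a :: α) (c :: β) = -(t * q⁻¹ ^ (a : ℕ)) * coeffD α (b :: β) := by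
  simp only [coeffD, size, List.map_cons, List.sum_cons, List.length_cons, Nat.cast_add,
    Nat.cast_one]
  rw [q_zpow_step, add_sub_right_comm (β.length : ℤ) 1, zpow_add_one₀ q_ne_zero,
    show (α.length : ℤ) + 1 - (β.length + 1) = (α.length - (β.length + 1)) + 1 by ring,
    zpow_add_one₀ (neg_ne_zero.2 t_ne_zero)]
  ring

theorem D_eq_sum (α : Comp) :
    D α = ((coarseningList α).map fun β => coeffD α β • M Cqt β).sum :=
  List.sum_toFinset _ (nodup_coarseningList α)

/-- The one or two coarsenings that stem from `β` match the terms of `attach` applied to `M_β`; for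
empty `β` there is nothing to fuse with, and `absorb` vanishes. -/
theorem attach_smul_M (a : ℕ+) (α β : Comp) :
    (((match β with
      | [] => [[a]]
      | b :: β' => [a :: b :: β', (a + b) :: β'] : List Comp)).map fun γ =>
        coeffD (a :: α) γ • M Cqt γ).sum =
      attach q q⁻¹ t a (coeffD α β • M Cqt β) := by
  cases β with
  | nil =>
    rw [map_smul, attach_apply, M_nil, absorb_one, smul_zero, sub_zero, prepend_one, smul_smul]
    simp only [List.map_cons, List.map_nil, List.sum_cons, List.sum_nil, add_zero]
    rw [coeffD_cons_cons, mul_comm]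
  | cons b β =>
    rw [map_smul, attach_apply, prepend_M, absorb_M_cons]
    simp only [List.map_cons, List.map_nil, List.sum_cons, List.sum_nil, add_zero]
    rw [coeffD_cons_cons a α (b :: β) a, coeffD_cons_merge a α β b (a + b), smul_sub, smul_smul,
      smul_smul, neg_mul, neg_smul, ← sub_eq_add_neg, mul_comm (coeffD α (b :: β)),
      mul_comm (coeffD α (b :: β))]

theorem D_eq_attachAll (α : Comp) : D α = attachAll q q⁻¹ t α := by
  rw [D_eq_sum]
  induction α with
  | nil => simp [coarseningList, coeffD, size, attachAll, M_nil]
  | cons a α ih =>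
    rw [attachAll, ← ih, map_list_sum, List.map_map, coarseningList]
    induction coarseningList α with
    | nil => rfl
    | cons β l ihl =>
      rw [List.flatMap_cons, List.map_append, List.sum_append, List.map_cons, List.sum_cons]
      exact congrArg₂ (· + ·) (attach_smul_M a α β) ihl

end Identification

/-! ### Positivity of the structure constants. -/

section NatPolynomials

/-- The rational functions in `ℕ[q,t]` form a subsemiring. -/
noncomputable def natSubsemiring : Subsemiring Cqt :=
  (MvPolynomial.aeval ![q, t] : MvPolynomial (Fin 2) ℕ →ₐ[ℕ] Cqt).toRingHom.rangeS

theorem q_mem_natSubsemiring : q ∈ natSubsemiring :=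
  ⟨MvPolynomial.X 0, by simp⟩

theorem t_mem_natSubsemiring : t ∈ natSubsemiring :=
  ⟨MvPolynomial.X 1, by simp⟩

theorem repr_mem_natSubsemiring {ι N : Type*} [AddCommMonoid N] [Module Cqt N]
    (b : Module.Basis ι Cqt N) (i j : ι) : b.repr (b i) j ∈ natSubsemiring := by
  classical
  rw [Module.Basis.repr_self, Finsupp.single_apply]
  split_ifs
  · exact one_mem _
  · exact zero_mem _

end NatPolynomials

theorem D_mul_D (α β : Comp) :
    D α * D β = ∑ γ ∈ twoWayShuffles α β, ((q + t) ^ c1 γ * t ^ c2 γ) • D (plus γ) := by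
  simp only [D_eq_attachAll]
  exact (sum_twoWayShuffles q q⁻¹ t α β).symm

theorem coproduct_D (γ : Comp) :
    coproduct Cqt (D γ) = ∑ p ∈ deconcatenations γ, D p.1 ⊗ₜ[Cqt] D p.2 := by
  simp only [D_eq_attachAll]
  exact coproduct_attachAll q q⁻¹ t γ

/-- Several expressions may share the same `γ⁺`, so a structure constant is a sum of weights `(q +
t)^i t^j`; closure under addition and multiplication suffices. -/
theorem repr_mul_mem_natSubsemiring {b : Module.Basis Comp Cqt (QSym Cqt)} (hb : ∀ α, b α = D α)
    (α β γ : Comp) : b.repr (D α * D β) γ ∈ natSubsemiring := by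
  rw [D_mul_D, map_sum, Finsupp.finsetSum_apply]
  refine sum_mem fun δ _ => ?_
  rw [map_smul, Finsupp.smul_apply, ← hb]
  exact mul_mem (mul_mem (pow_mem (add_mem q_mem_natSubsemiring t_mem_natSubsemiring) _)
    (pow_mem t_mem_natSubsemiring _)) (repr_mem_natSubsemiring b _ _)

theorem repr_coproduct_mem_natSubsemiring {b : Module.Basis Comp Cqt (QSym Cqt)}
    (hb : ∀ α, b α = D α) (γ : Comp) (p : Comp × Comp) :
    (b.tensorProduct b).repr (coproduct Cqt (D γ)) p ∈ natSubsemiring := by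
  rw [coproduct_D, map_sum, Finsupp.finsetSum_apply]
  refine sum_mem fun δ _ => ?_
  rw [← hb, ← hb, ← Module.Basis.tensorProduct_apply]
  exact repr_mem_natSubsemiring (b.tensorProduct b) _ _

end QS
theorem mainTheorem1 :
    -- (a) the product rule
    (∀ α β : QS.Comp,
      QS.D α * QS.D β =
        ∑ γ ∈ QS.twoWayShuffles α β,
          ((QS.q + QS.t) ^ QS.c1 γ * QS.t ^ QS.c2 γ) • QS.D (QS.plus γ)) ∧
    -- (b) the coproduct rule
    (∀ γ : QS.Comp,
      QS.coproduct QS.Cqt (QS.D γ) =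
        ∑ p ∈ QS.deconcatenations γ, QS.D p.1 ⊗ₜ[QS.Cqt] QS.D p.2) ∧
    -- the `D_α` form a basis, and all structure constants in this basis lie in `ℕ[q,t]`
    (∃ b : Module.Basis QS.Comp QS.Cqt (QS.QSym QS.Cqt),
      (∀ α, b α = QS.D α) ∧
      (∀ α β γ, b.repr (QS.D α * QS.D β) γ ∈ QS.natPolynomials) ∧
      (∀ γ α β, (b.tensorProduct b).repr (QS.coproduct QS.Cqt (QS.D γ)) (α, β) ∈
        QS.natPolynomials)) :=
  have hb α := (QS.basisAttachAll_apply (mul_inv_cancel₀ QS.q_ne_zero) QS.t α).trans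
    (QS.D_eq_attachAll α).symm
  ⟨QS.D_mul_D, QS.coproduct_D, QS.basisAttachAll (mul_inv_cancel₀ QS.q_ne_zero) QS.t, hb,
    QS.repr_mul_mem_natSubsemiring hb,
    fun γ α β => QS.repr_coproduct_mem_natSubsemiring hb γ (α, β)⟩
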